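/- **Conventions.** A signature $\tau$ is a collection of relation symbols with arities; a $\tau$-structure $\mathbb H$ is a countable set $H$ with a relation $R(\mathbb H)\subseteq H^k$ for every $k$-ary $R\in\tau$. The degree of an element is the number of tuples (of all the relations) in which it occurs. An element $b$ *dominates* $a$ in $\mathbb J$ if, for every relation symbol $R$, replacing in a tuple of $R(\mathbb J)$ any one entry equal to $a$ by $b$ gives again a tuple of $R(\mathbb J)$. A structure *dismantles* to an induced substructure if the latter is reached by finitely many steps, each of which passes from the current structure $\mathbb J$ to its substructure induced by $J\setminus\{a\}$, where $a\in J$ is dominated in $\mathbb J$ by some $b\in J$, $b\neq a$. $\mathbb H^2$ is the product structure on $H\times H$ and $\Delta(\mathbb H^2)$ its substructure induced by the diagonal $\{(a,a): a\in H\}$. Let $\mathbb H$ be finite, $\mathbb G$ of bounded degree, and $\lambda:H\to(0,\infty)$ a weight function. For a finite $V\subseteq G$, $\phi\in\mathrm{Hom}(\mathbb G,\mathbb H)$ and a pattern $\eta:V\to H$, put $\mathbb P_{V,\phi}(\eta)=Z_{V,\phi}(\lambda)^{-1}\prod_{x\in V}\lambda(\eta(x))$ if the map equal to $\eta$ on $V$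 and to $\phi$ on $G\setminus V$ is a homomorphism, and $\mathbb P_{V,\phi}(\eta)=0$ otherwise, where $Z_{V,\phi}(\lambda)$ normalizes $\mathbb P_{V,\phi}$ to a probability on $H^V$. Give $\mathrm{Hom}(\mathbb G,\mathbb H)$ the $\sigma$-algebra generated by the events $A(\psi,V)=\{\chi:\chi|_V=\psi|_V\}$, $V$ finite. A probability measure $\mu$ on $\mathrm{Hom}(\mathbb G,\mathbb H)$ is a *Gibbs measure* for the Gibbs $(\mathbb G,\mathbb H,\lambda)$-specification if for all finite $V\subseteq G$ and all $\psi\in\mathrm{Hom}(\mathbb G,\mathbb H)$ the conditional probability of $A(\psi,V)$ given the values on $G\setminus V$ equals $\mathbb P_{V,\phi}(\psi|_V)$ for $\mu$-almost every $\phi$. **Proposition.** Let $\tau=\{R_1,R_2,R_3\}$ consist of three binary relation symbols. There is a finite $\tau$-structure $\mathbb H$ such that $\mathbb H^2$ dismantles to its full diagonal $\Delta(\mathbb H^2)$ and such that, for every $\Delta\ge 6$, the following holds. Let $\mathbb G$ be the disjoint union of three copies of the $\Delta$-regular tree, $R_i(\mathbb G)$ being the adjacency relation of the $i$-th copy. Then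 $\mathbb G$ has bounded degree, and for every $\lambda:H\to(0,\infty)$ there are at least two distinct Gibbs measures for the Gibbs $(\mathbb G,\mathbb H,\lambda)$-specification. Hence it is not true that, for every signature $\tau$ and every finite $\tau$-structure $\mathbb H$ whose square dismantles to a substructure of its diagonal, every $\tau$-structure $\mathbb G$ of bounded degree with $\mathrm{Hom}(\mathbb G,\mathbb H)\neq\emptyset$ admits some $\lambda:H\to(0,\infty)$ for which the Gibbs $(\mathbb G,\mathbb H,\lambda)$-specification has exactly one Gibbs measure. -/

import Mathlib

open MeasureTheory ProbabilityTheory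
open scoped FirstOrder

noncomputable section

namespace RelStr

open FirstOrder.Language.Structure (funMap RelMap)

/-! A signature is a language `L` without function symbols (`L.IsRelational`), and a relational
structure over it is a type with an `L.Structure` instance; homomorphisms are `G →[L] H`. -/

/-- The product of two structures: a tuple of pairs is in a relation iff both of its coordinate
tuples are. -/
instance prodStructure (L : FirstOrder.Language.{0, 0}) (M N : Type) [L.Structure M] [L.Structure N] :
    L.Structure (M × N) where
  funMap f x := (funMap f (fun i => (x i).1), funMap f (fun i => (x i).2))
  RelMap R x := RelMap R (fun i => (x i).1) ∧ RelMap R (fun i => (x i).2)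

section Dismantling

variable (L : FirstOrder.Language.{0, 0}) {M : Type} [L.Structure M]

/-- `b` dominates `a` in the substructure induced by `S`: in every tuple of a relation with all
entries in `S`, any single entry equal to `a` can be replaced by `b`. -/
def DominatesIn (S : Set M) (b a : M) : Prop :=
  ∀ (n : ℕ) (R : L.Relations n) (x : Fin n → M), (∀ j, x j ∈ S) → RelMap R x →
    ∀ i : Fin n, x i = a → RelMap R (Function.update x i b)

/-- One fold: `S'` is `S` without one element `a` that is dominated, in the substructure induced
by `S`, by another element `b` of `S`. -/
def FoldsTo (S S' : Set M) : Prop :=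
  ∃ a ∈ S, ∃ b ∈ S, a ≠ b ∧ DominatesIn L S b a ∧ S' = S \ {a}

variable (M) in
/-- The structure `M` dismantles to its substructure induced by `K`, through a finite sequence of
folds. -/
def DismantlesTo (K : Set M) : Prop :=
  Relation.ReflTransGen (FoldsTo L) (Set.univ : Set M) K

end Dismantling

/-- The tuples of (all the relations of) the structure `G` in which the element `g` occurs. -/
def tuplesThrough (L : FirstOrder.Language.{0, 0}) {G : Type} [L.Structure G] (g : G) :
    Set (Σ n : ℕ, L.Relations n × (Fin n → G)) :=
  {t | RelMap t.2.1 t.2.2 ∧ ∃ i, t.2.2 i = g}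

/-- Bounded degree, the degree of an element being the number of tuples in which it occurs. -/
def BoundedDegree (L : FirstOrder.Language.{0, 0}) (G : Type) [L.Structure G] : Prop :=
  ∃ d : ℕ, ∀ g : G, (tuplesThrough L g).encard ≤ d

section Gibbs

variable {L : FirstOrder.Language.{0, 0}} {G H : Type} [L.Structure G] [L.Structure H]

/-- The event that a homomorphism agrees with `φ` on `V`. -/
def agreeOn (φ : G →[L] H) (V : Set G) : Set (G →[L] H) :=
  {ψ | ∀ x ∈ V, ψ x = φ x}

variable (L G H) in
/-- The σ-algebra on `Hom(G, H)` of the events that depend on the values on `U`: it is generated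
by the events `agreeOn φ V` with `V` a finite subset of `U`. -/
@[reducible] def sigmaOn (U : Set G) : MeasurableSpace (G →[L] H) :=
  MeasurableSpace.generateFrom
    {A | ∃ (φ : G →[L] H) (V : Finset G), (V : Set G) ⊆ U ∧ A = agreeOn φ (V : Set G)}

/-- The σ-algebra on `Hom(G, H)` generated by all the events `agreeOn φ V`, `V` finite. -/
instance homMeasurableSpace : MeasurableSpace (G →[L] H) :=
  sigmaOn L G H Set.univ

open Classical in
/-- The map that is `η` on `V` and `φ` outside of `V`. -/
def glue (V : Finset G) (η : V → H) (φ : G → H) : G → H :=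
  fun x => if h : x ∈ V then η ⟨x, h⟩ else φ x

variable (L) in
/-- The map `f` is a homomorphism. -/
def IsHom (f : G → H) : Prop :=
  ∃ χ : G →[L] H, (χ : G → H) = f

open Classical in
/-- The weight `∏_{x ∈ V} lam (η x)` of a pattern `η` on `V` if the pattern fits the boundary
condition `φ`, and `0` if it does not. -/
def patternWeight (lam : H → ℝ) (V : Finset G) (φ : G →[L] H) (η : V → H) : ℝ :=
  if IsHom L (glue V η φ) then ∏ x : V, lam (η x) else 0

open Classical in
/-- The partition function `Z_{V, φ}(lam)`: the sum of the weights of all patterns on `V`. -/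
def partitionFunction [Fintype H] (lam : H → ℝ) (V : Finset G) (φ : G →[L] H) : ℝ :=
  ∑ η : V → H, patternWeight lam V φ η

/-- The probability that the Gibbs specification gives, in the finite set `V` and under the
boundary condition `φ`, to the pattern `η` on `V`. -/
def specification [Fintype H] (lam : H → ℝ) (V : Finset G) (φ : G →[L] H) (η : V → H) : ℝ :=
  (partitionFunction lam V φ)⁻¹ * patternWeight lam V φ η

/-- `μ` is a Gibbs measure for the Gibbs `(G, H, lam)`-specification: it is a probability measure
on `Hom(G, H)` such that for every finite `V` and every `ψ` the conditional probability of
agreeing with `ψ` on `V`, given the values outside of `V`, is almost surely the one prescribed by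
the specification. -/
structure IsGibbs [Fintype H] (lam : H → ℝ) (μ : Measure (G →[L] H)) : Prop where
  isProbabilityMeasure : IsProbabilityMeasure μ
  condProb_eq : ∀ (V : Finset G) (ψ : G →[L] H),
    μ⟦agreeOn ψ (V : Set G) | sigmaOn L G H (V : Set G)ᶜ⟧
      =ᵐ[μ] fun φ => specification lam V φ (fun x => ψ x)

end Gibbs

/-- The relation symbols of a signature with three symbols, all of arity two. -/
inductive ThreeBinaryRel : ℕ → Type
  | R (i : Fin 3) : ThreeBinaryRel 2

/-- The signature that consists of three binary relation symbols. -/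
def threeBinary : FirstOrder.Language.{0, 0} := ⟨fun _ => Empty, ThreeBinaryRel⟩

instance threeBinary_isRelational : threeBinary.IsRelational :=
  fun _ => inferInstanceAs (IsEmpty Empty)

/-- The disjoint union of three copies of the vertex set of the graph `T`. -/
def ThreeCopies {V : Type} (_T : SimpleGraph V) : Type := Fin 3 × V

/-- The disjoint union of three copies of `T`, where the `i`-th relation is adjacency in the
`i`-th copy. -/
instance threeCopiesStructure {V : Type} (T : SimpleGraph V) :
    threeBinary.Structure (ThreeCopies T) where
  funMap f := Empty.elim f
  RelMap R :=
    match R with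
    | ThreeBinaryRel.R i => fun x : Fin 2 → Fin 3 × V =>
        (x 0).1 = i ∧ (x 1).1 = i ∧ T.Adj (x 0).2 (x 1).2

end RelStr

end

/-!
The structure is `Fin 3` with three hard-core constraints in cyclic order: the `i`-th relation joins
an occupied letter `i` to an empty letter `i + 1`, and `i + 1` to itself. Two distinct letters `a`,
`a + 1` have neighbours in a common relation only for the relation `a`, where every neighbour of `a`
is one of `a + 1`; so in the square `(a, a + 1)` and `(a + 1, a)` are dominated by
`(a + 1, a + 1)`, and the square dismantles to its diagonal (`dismantlesTo_diagonal`).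

A homomorphism from the three trees is a triple of independent sets, and a Gibbs measure on the
`i`-th copy is one of the hard-core model of activity `r i = lam i / lam (i + 1)`. The product of
the three activities is `1`, hence one of them is at least `1`. For degree at least `6` the critical
activity of the tree is below `1`, so this copy has a phase transition, whatever `lam` is.

The Gibbs measures are written down as tree-indexed Markov chains. Every vertex `v` tosses a coin
with odds `x v`, and starting from the root a vertex is occupied if its coin succeeds and its parent
is not occupied. On a finite set that contains the parents of its elements the probability of a
configuration is a product over the vertices in which an occupied vertex contributes
`x v * ∏ (1 + x c)`, the product being over its children `c` in the set
(`RootedForest.coins_real_occupied_eq`). If `x v * ∏ (1 + x c)` over all the children is the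
activity, this product form gives the prescribed conditional probabilities
(`isGibbs_of_product_form`, `RootedForest.isGibbs_homMeasure`).

Odds that alternate between the values `y` and `z` along the levels of the tree of degree `d + 1`
solve these equations iff `y * (1 + z) ^ d` and `z * (1 + y) ^ d` both equal the activity. A
solution with `y = z` always exists; for activity at least `1` and `d ≥ 5` there is also one with
`y ≠ z` (`exists_ne_mul_one_add_pow_eq`), and exchanging `y` and `z` in it changes the probability
that the root is occupied.
-/

namespace RelStr

open FirstOrder.Language.Structure (funMap RelMap)

/-! ### A criterion for Gibbs measures -/

section Criterion

variable {L : FirstOrder.Language.{0, 0}} {G H : Type} [L.Structure G] [L.Structure H]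

lemma measurableSet_agreeOn {U : Set G} (φ : G →[L] H) (V : Finset G) (hV : (V : Set G) ⊆ U) :
    MeasurableSet[sigmaOn L G H U] (agreeOn φ (V : Set G)) :=
  MeasurableSpace.measurableSet_generateFrom ⟨φ, V, hV, rfl⟩

lemma sigmaOn_le (U : Set G) : sigmaOn L G H U ≤ homMeasurableSpace :=
  MeasurableSpace.generateFrom_mono fun _ ⟨φ, V, _, h⟩ => ⟨φ, V, Set.subset_univ _, h⟩

lemma agreeOn_eq_of_mem {φ χ : G →[L] H} {V : Set G} (h : χ ∈ agreeOn φ V) :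
    agreeOn χ V = agreeOn φ V := by
  ext ψ
  exact forall₂_congr fun x hx => by rw [h x hx]

/-- As the target is finite, only finitely many events fix the values on a finite set, and an event
determined by these values is their disjoint union. -/
lemma exists_finite_sUnion_eq [Finite H] (V : Finset G) (B : Set (G →[L] H))
    (hB : ∀ χ ∈ B, agreeOn χ (V : Set G) ⊆ B) :
    ∃ S : Set (Set (G →[L] H)), S.Finite ∧ S.PairwiseDisjoint id ∧
      (∀ A ∈ S, ∃ χ, A = agreeOn χ (V : Set G)) ∧ B = ⋃₀ S := by
  refine ⟨(fun χ : G →[L] H => agreeOn χ (V : Set G)) '' B, ?_, ?_, ?_, ?_⟩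
  · refine (Set.finite_range fun η : V → H => {ψ : G →[L] H | ∀ x : V, ψ x = η x}).subset ?_
    rintro _ ⟨χ, -, rfl⟩
    exact ⟨fun x => χ x, by ext ψ; simp [agreeOn]⟩
  · rintro _ ⟨χ, -, rfl⟩ _ ⟨χ', -, rfl⟩ hne
    refine Set.disjoint_left.2 fun σ h h' => hne ?_
    exact (agreeOn_eq_of_mem h).symm.trans (agreeOn_eq_of_mem h')
  · rintro _ ⟨χ, -, rfl⟩
    exact ⟨χ, rfl⟩
  · ext χ
    constructor
    · exact fun h => ⟨_, ⟨χ, h, rfl⟩, fun _ _ => rfl⟩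
    · rintro ⟨_, ⟨χ', h, rfl⟩, hχ⟩
      exact hB χ' h hχ

lemma measurableSet_of_agreeOn_subset [Finite H] (m : MeasurableSpace (G →[L] H)) (V : Finset G)
    (hV : ∀ χ : G →[L] H, MeasurableSet[m] (agreeOn χ (V : Set G))) (B : Set (G →[L] H))
    (hB : ∀ χ ∈ B, agreeOn χ (V : Set G) ⊆ B) : MeasurableSet[m] B := by
  obtain ⟨S, hfin, -, hS, rfl⟩ := exists_finite_sUnion_eq V B hB
  refine Set.Finite.measurableSet_sUnion hfin fun A hA => ?_
  obtain ⟨χ, rfl⟩ := hS A hA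
  exact hV χ

lemma measure_eq_of_agreeOn_subset [Finite H] (μ ν : Measure (G →[L] H)) (V : Finset G)
    (hV : ∀ χ : G →[L] H, μ (agreeOn χ (V : Set G)) = ν (agreeOn χ (V : Set G)))
    (B : Set (G →[L] H)) (hB : ∀ χ ∈ B, agreeOn χ (V : Set G) ⊆ B) : μ B = ν B := by
  obtain ⟨S, hfin, hdisj, hS, rfl⟩ := exists_finite_sUnion_eq V B hB
  have hm : ∀ A ∈ S, MeasurableSet A := fun A hA => by
    obtain ⟨χ, rfl⟩ := hS A hA
    exact measurableSet_agreeOn χ V (Set.subset_univ _)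
  rw [measure_sUnion hfin.countable hdisj hm, measure_sUnion hfin.countable hdisj hm]
  refine tsum_congr fun A => ?_
  obtain ⟨χ, hχ⟩ := hS A A.2
  rw [hχ, hV]

lemma isPiSystem_agreeOn (U : Set G) :
    IsPiSystem {A | ∃ (φ : G →[L] H) (V : Finset G), (V : Set G) ⊆ U ∧
      A = agreeOn φ (V : Set G)} := by
  classical
  rintro _ ⟨φ, V, hV, rfl⟩ _ ⟨φ', V', hV', rfl⟩ ⟨χ, h, h'⟩
  refine ⟨χ, V ∪ V', by simp [hV, hV'], ?_⟩
  rw [← agreeOn_eq_of_mem h, ← agreeOn_eq_of_mem h']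
  ext ψ
  simp [agreeOn, or_imp, forall_and]

/-- `F` contains `V` together with all neighbours of `V`. -/
def Surrounds (L : FirstOrder.Language.{0, 0}) {G : Type} [L.Structure G] (F V : Finset G) : Prop :=
  V ⊆ F ∧ ∀ (n : ℕ) (R : L.Relations n) (x : Fin n → G), RelMap R x → (∃ i, x i ∈ V) →
    ∀ i, x i ∈ F

lemma glue_of_mem {V : Finset G} {η : V → H} {φ : G → H} {x : G} (h : x ∈ V) :
    glue V η φ x = η ⟨x, h⟩ := dif_pos h

lemma glue_of_notMem {V : Finset G} {η : V → H} {φ : G → H} {x : G} (h : x ∉ V) :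
    glue V η φ x = φ x := dif_neg h

/-- Whether a pattern on `V` fits a boundary condition is decided on a neighbourhood of `V`. -/
lemma isHom_glue_of_agree [L.IsRelational] {F V : Finset G} (hF : Surrounds L F V) (η : V → H)
    (χ σ : G →[L] H) (h : ∀ x ∈ F, σ x = glue V η χ x) : IsHom L (glue V η χ) := by
  refine ⟨⟨glue V η χ, fun f => isEmptyElim f, fun {n} R x hx => ?_⟩, rfl⟩
  by_cases hV : ∃ i, x i ∈ V
  · have : glue V η χ ∘ x = σ ∘ x := funext fun i => (h _ (hF.2 n R x hx hV i)).symm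
    rw [this]
    exact σ.map_rel R x hx
  · push Not at hV
    have : glue V η χ ∘ x = χ ∘ x := funext fun i => glue_of_notMem (hV i)
    rw [this]
    exact χ.map_rel R x hx

lemma specification_congr [Fintype H] [L.IsRelational] {F V : Finset G} (hF : Surrounds L F V)
    (lam : H → ℝ) {χ χ' : G →[L] H} (h : χ' ∈ agreeOn χ (F \ V : Set G)) (η : V → H) :
    specification lam V χ' η = specification lam V χ η := by
  have key : ∀ χ χ' : G →[L] H, χ' ∈ agreeOn χ (F \ V : Set G) → ∀ η : V → H,
      IsHom L (glue V η χ) → IsHom L (glue V η χ') := by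
    rintro χ χ' h η ⟨σ, hσ⟩
    refine isHom_glue_of_agree hF η χ' σ fun x hx => ?_
    rw [hσ]
    by_cases hxV : x ∈ V
    · rw [glue_of_mem hxV, glue_of_mem hxV]
    · rw [glue_of_notMem hxV, glue_of_notMem hxV, h x ⟨hx, hxV⟩]
  have hw : patternWeight lam V χ' = patternWeight lam V χ := by
    funext η
    have : IsHom L (glue V η χ') ↔ IsHom L (glue V η χ) :=
      ⟨key χ' χ (fun x hx => (h x hx).symm) η, key χ χ' h η⟩
    by_cases hη : IsHom L (glue V η χ)
    · rw [patternWeight, patternWeight, if_pos hη, if_pos (this.2 hη)]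
    · rw [patternWeight, patternWeight, if_neg hη, if_neg (mt this.1 hη)]
  simp only [specification, partitionFunction, hw]

lemma patternWeight_nonneg {lam : H → ℝ} (hlam : ∀ a, 0 < lam a) (V : Finset G)
    (χ : G →[L] H) (η : V → H) : 0 ≤ patternWeight lam V χ η := by
  unfold patternWeight
  split_ifs
  · exact Finset.prod_nonneg fun x _ => (hlam _).le
  · exact le_rfl

lemma partitionFunction_pos [Fintype H] {lam : H → ℝ} (hlam : ∀ a, 0 < lam a) (V : Finset G)
    (χ : G →[L] H) : 0 < partitionFunction lam V χ := by
  classical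
  refine Finset.sum_pos' (fun η _ => patternWeight_nonneg hlam V χ η)
    ⟨fun x => χ x, Finset.mem_univ _, ?_⟩
  have : IsHom L (glue V (fun x => χ x) χ) := ⟨χ, by funext x; simp [glue]⟩
  rw [patternWeight, if_pos this]
  exact Finset.prod_pos fun x _ => hlam _

lemma specification_le_one [Fintype H] {lam : H → ℝ} (hlam : ∀ a, 0 < lam a) (V : Finset G)
    (χ : G →[L] H) (η : V → H) : specification lam V χ η ≤ 1 := by
  classical
  rw [specification, inv_mul_le_one₀ (partitionFunction_pos hlam V χ)]
  exact Finset.single_le_sum (fun η _ => patternWeight_nonneg hlam V χ η) (Finset.mem_univ η)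

/-- If the probabilities of the patterns on `F` have product form, with factors proportional to
`lam` on the part `V` of `F`, then the patterns on `V` have the conditional probabilities of the
specification given the values on `F \ V`. -/
lemma specification_mul_measureReal_agreeOn [Fintype H] [L.IsRelational] {lam : H → ℝ}
    (hlam : ∀ a, 0 < lam a) (μ : Measure (G →[L] H)) [IsFiniteMeasure μ] {F V : Finset G}
    (hF : Surrounds L F V) (g : G → H → ℝ) (c : G → ℝ)
    (hg : ∀ ζ : G →[L] H, μ.real (agreeOn ζ (F : Set G)) = ∏ v ∈ F, g v (ζ v))
    (hc : ∀ ζ : G →[L] H, ∀ v ∈ V, g v (ζ v) = c v * lam (ζ v)) (χ ψ : G →[L] H) :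
    specification lam V χ (fun x => ψ x) * μ.real (agreeOn χ (F \ V : Set G))
      = μ.real (agreeOn χ (F \ V : Set G) ∩ agreeOn ψ (V : Set G)) := by
  classical
  set K : ℝ := (∏ v ∈ F \ V, g v (χ v)) * ∏ v ∈ V, c v with hK
  have hmeas : ∀ (φ : G →[L] H) (W : Finset G), MeasurableSet (agreeOn φ (W : Set G)) :=
    fun φ W => measurableSet_agreeOn φ W (Set.subset_univ _)
  let C : (V → H) → Set (G →[L] H) := fun η =>
    agreeOn χ (F \ V : Set G) ∩ {σ | ∀ x : V, σ x = η x}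
  have hCF : ∀ η σ, σ ∈ C η ↔ ∀ x ∈ F, σ x = glue V η χ x := by
    intro η σ
    constructor
    · rintro ⟨h1, h2⟩ x hx
      by_cases hxV : x ∈ V
      · rw [glue_of_mem hxV]; exact h2 ⟨x, hxV⟩
      · rw [glue_of_notMem hxV]; exact h1 x ⟨hx, hxV⟩
    · intro h
      refine ⟨fun x hx => ?_, fun x => ?_⟩
      · rw [h x hx.1, glue_of_notMem hx.2]
      · rw [h x (hF.1 x.2), glue_of_mem x.2]
  have hC : ∀ η, MeasurableSet (C η) ∧ μ.real (C η) = K * patternWeight lam V χ η := by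
    intro η
    by_cases hη : IsHom L (glue V η χ)
    · obtain ⟨ζ, hζ⟩ := id hη
      have hCζ : C η = agreeOn ζ (F : Set G) := by
        ext σ
        rw [hCF, ← hζ]
        rfl
      refine ⟨hCζ ▸ hmeas ζ F, ?_⟩
      have h1 : ∏ v ∈ F \ V, g v (ζ v) = ∏ v ∈ F \ V, g v (χ v) :=
        Finset.prod_congr rfl fun v hv => by
          rw [hζ, glue_of_notMem (Finset.mem_sdiff.1 hv).2]
      have h2 : ∏ v ∈ V, g v (ζ v) = (∏ v ∈ V, c v) * ∏ x : V, lam (η x) := by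
        rw [Finset.prod_congr rfl (hc ζ), Finset.prod_mul_distrib, ← Finset.prod_coe_sort V
          (fun v => lam (ζ v))]
        congr 1
        exact Finset.prod_congr rfl fun x _ => by rw [hζ, glue_of_mem x.2]
      rw [hCζ, hg, ← Finset.prod_sdiff hF.1, h1, h2, patternWeight, if_pos hη, hK, mul_assoc]
    · have : C η = ∅ := Set.eq_empty_of_forall_notMem fun σ hσ =>
        hη (isHom_glue_of_agree hF η χ σ ((hCF η σ).1 hσ))
      rw [this, patternWeight, if_neg hη]
      simp
  have hsum : μ.real (agreeOn χ (F \ V : Set G)) = K * partitionFunction lam V χ := by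
    have hU : agreeOn χ (F \ V : Set G) = ⋃ η ∈ (Finset.univ : Finset (V → H)), C η := by
      ext σ
      simp only [Finset.mem_univ, Set.iUnion_true, Set.mem_iUnion]
      exact ⟨fun h => ⟨fun x => σ x, h, fun _ => rfl⟩, fun ⟨_, h⟩ => h.1⟩
    rw [hU, measureReal_biUnion_finset _ (fun η _ => (hC η).1), partitionFunction, Finset.mul_sum]
    · exact Finset.sum_congr rfl fun η _ => (hC η).2
    · intro η _ η' _ hne
      refine Set.disjoint_left.2 fun σ h h' => hne (funext fun x => ?_)
      rw [← h.2 x, ← h'.2 x]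
  have hψ : agreeOn χ (F \ V : Set G) ∩ agreeOn ψ (V : Set G) = C (fun x => ψ x) := by
    ext σ
    simp [C, agreeOn]
  rw [hψ, (hC _).2, hsum, specification]
  have := (partitionFunction_pos hlam V χ).ne'
  field_simp

/-- A criterion for Gibbs measures by finite-dimensional probabilities: it is enough that every
finite set `W` lies in a finite set `F` that surrounds the given `V` and whose patterns have
probabilities of product form, with factors proportional to `lam` on `V`. -/
theorem isGibbs_of_product_form [Fintype H] [L.IsRelational] {lam : H → ℝ}
    (hlam : ∀ a, 0 < lam a) (μ : Measure (G →[L] H)) [IsProbabilityMeasure μ]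
    (h : ∀ V W : Finset G, ∃ F : Finset G, Surrounds L F V ∧ W ⊆ F ∧
      ∃ (g : G → H → ℝ) (c : G → ℝ),
        (∀ ζ : G →[L] H, μ.real (agreeOn ζ (F : Set G)) = ∏ v ∈ F, g v (ζ v)) ∧
        ∀ ζ : G →[L] H, ∀ v ∈ V, g v (ζ v) = c v * lam (ζ v)) :
    IsGibbs lam μ := by
  classical
  refine ⟨inferInstance, fun V ψ => ?_⟩
  have hmeas : ∀ (φ : G →[L] H) (W : Finset G), MeasurableSet (agreeOn φ (W : Set G)) :=
    fun φ W => measurableSet_agreeOn φ W (Set.subset_univ _)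
  set f : (G →[L] H) → ℝ := fun φ => specification lam V φ (fun x => ψ x) with hf
  -- `f` is determined by the values on the finite set `F₀ \ V`, hence measurable
  obtain ⟨F₀, hF₀, -, -⟩ := h V ∅
  have hfm : Measurable[sigmaOn L G H (V : Set G)ᶜ] f := by
    intro s _
    refine measurableSet_of_agreeOn_subset _ (F₀ \ V)
      (fun χ => measurableSet_agreeOn χ _ (by intro x hx; simp at hx; simpa using hx.2)) _ ?_
    intro χ hχ χ' hχ'
    rw [Finset.coe_sdiff] at hχ'
    simpa [hf, specification_congr hF₀ lam hχ'] using hχ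
  have hf0 : ∀ φ, 0 ≤ f φ := fun φ =>
    mul_nonneg (inv_nonneg.2 (partitionFunction_pos hlam V φ).le) (patternWeight_nonneg hlam V φ _)
  have hfm' : Measurable f := hfm.mono (sigmaOn_le _) le_rfl
  have hint : Integrable f μ :=
    Integrable.of_bound hfm'.aestronglyMeasurable 1 (Filter.Eventually.of_forall fun φ => by
      rw [Real.norm_of_nonneg (hf0 φ)]
      exact specification_le_one hlam V φ _)
  -- on the events of `sigmaOn Vᶜ`, integrating `f` gives the probability of agreeing with `ψ`
  have hkey : ∀ A, MeasurableSet[sigmaOn L G H (V : Set G)ᶜ] A →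
      μ.withDensity (fun φ => ENNReal.ofReal (f φ)) A = μ.restrict (agreeOn ψ (V : Set G)) A := by
    have hatom : ∀ W : Finset G, (W : Set G) ⊆ (V : Set G)ᶜ → ∀ B : Set (G →[L] H),
        (∀ χ ∈ B, agreeOn χ (W : Set G) ⊆ B) →
        μ.withDensity (fun φ => ENNReal.ofReal (f φ)) B
          = μ.restrict (agreeOn ψ (V : Set G)) B := by
      intro W hW B hB
      -- an event determined by the values on `W` is also determined by those on the larger `F \ V`
      obtain ⟨F, hF, hWF, g, c, hg, hc⟩ := h V W
      refine measure_eq_of_agreeOn_subset _ _ (F \ V) (fun χ => ?_) B fun χ hχ χ' hχ' =>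
        hB χ hχ fun x hx => hχ' x (by simpa using ⟨hWF hx, hW hx⟩)
      rw [withDensity_apply _ (hmeas χ _), Measure.restrict_apply (hmeas χ _),
        setLIntegral_congr_fun (g := fun _ => ENNReal.ofReal (f χ)) (hmeas χ _),
        setLIntegral_const, Finset.coe_sdiff, ← ofReal_measureReal, ← ofReal_measureReal,
        ← specification_mul_measureReal_agreeOn hlam μ hF g c hg hc χ ψ,
        ENNReal.ofReal_mul (hf0 χ)]
      intro χ' hχ'
      rw [Finset.coe_sdiff] at hχ'
      simp only [hf, specification_congr hF lam hχ']
    intro A hA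
    have : IsFiniteMeasure (μ.withDensity (fun φ => ENNReal.ofReal (f φ))) :=
      isFiniteMeasure_withDensity_ofReal hint.2
    refine ext_on_measurableSpace_of_generate_finite _ _ ?_ (sigmaOn_le _) rfl
      (isPiSystem_agreeOn _) (hatom ∅ (by simp) _ fun _ _ => Set.subset_univ _) hA
    rintro _ ⟨φ, W, hW, rfl⟩
    exact hatom W hW _ fun χ hχ => (agreeOn_eq_of_mem hχ).le
  symm
  refine ae_eq_condExp_of_forall_setIntegral_eq (sigmaOn_le _)
    ((integrable_const (1 : ℝ)).indicator (hmeas ψ V)) (fun _ _ _ => hint.integrableOn) ?_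
    hfm.stronglyMeasurable.aestronglyMeasurable
  intro A hA _
  rw [integral_indicator (hmeas ψ V), Measure.restrict_restrict (hmeas ψ V), setIntegral_const,
    smul_eq_mul, mul_one, integral_eq_lintegral_of_nonneg_ae (Filter.Eventually.of_forall hf0)
      hfm'.aestronglyMeasurable, ← withDensity_apply _ (sigmaOn_le _ _ hA), hkey A hA,
    Measure.restrict_apply (sigmaOn_le _ _ hA), Set.inter_comm]
  rfl

end Criterion

/-! ### Random independent sets of rooted forests -/

/-- A locally finite rooted forest on `G`: the map to the parent, undefined at the roots, with the
finite sets of children. A rank that decreases towards the parent makes it well-founded. -/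
structure RootedForest (G : Type) where
  par : G → Option G
  rank : G → ℕ
  rank_lt : ∀ {v u : G}, par v = some u → rank u < rank v
  children : G → Finset G
  mem_children : ∀ {c v : G}, c ∈ children v ↔ par c = some v

namespace RootedForest

variable {G : Type} (T : RootedForest G)

/-- No vertex is occupied together with its parent. -/
def Independent (ζ : G → Bool) : Prop :=
  ∀ v u, T.par v = some u → ζ v = true → ζ u = false

/-- The configuration obtained from the coins `B` by occupying, from the roots on, each vertex with
a successful coin whose parent has not been occupied. -/
def occupied (B : G → Bool) (v : G) : Bool :=
  match _h : T.par v with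
  | none => B v
  | some u => B v && !occupied B u
termination_by T.rank v
decreasing_by exact T.rank_lt _h

lemma occupied_iff (B : G → Bool) (v : G) :
    T.occupied B v = true ↔ B v = true ∧ ∀ u, T.par v = some u → T.occupied B u = false := by
  rw [occupied]
  split
  next h => simp [h]
  next u h => simp [h]

lemma independent_occupied (B : G → Bool) : T.Independent (T.occupied B) :=
  fun v u h hv => ((T.occupied_iff B v).1 hv).2 u h

lemma measurable_occupied (v : G) : Measurable fun B : G → Bool => T.occupied B v := by
  induction hn : T.rank v using Nat.strong_induction_on generalizing v with
  | _ n ih =>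
    subst hn
    rcases h : T.par v with _ | u
    · have : (fun B : G → Bool => T.occupied B v) = fun B => B v := by
        funext B
        rw [Bool.eq_iff_iff, occupied_iff]
        simp [h]
      rw [this]
      exact measurable_pi_apply v
    · have : (fun B : G → Bool => T.occupied B v) = fun B => B v && !T.occupied B u := by
        funext B
        rw [Bool.eq_iff_iff, occupied_iff]
        simp [h]
      rw [this]
      exact (Measurable.of_discrete (f := fun b : Bool × Bool => b.1 && !b.2)).comp
        ((measurable_pi_apply v).prodMk (ih _ (T.rank_lt h) u rfl))

/-- The set `A` contains the parents of its elements. -/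
def ParentClosed (A : Finset G) : Prop := ∀ v ∈ A, ∀ u, T.par v = some u → u ∈ A

lemma exists_parentClosed_superset (A : Finset G) : ∃ A', A ⊆ A' ∧ T.ParentClosed A' := by
  classical
  have hsingle : ∀ v, ∃ A', v ∈ A' ∧ T.ParentClosed A' := by
    intro v
    induction hn : T.rank v using Nat.strong_induction_on generalizing v with
    | _ n ih =>
      subst hn
      rcases h : T.par v with _ | u
      · refine ⟨{v}, by simp, fun w hw u hu => ?_⟩
        rw [Finset.mem_singleton.1 hw, h] at hu
        cases hu
      · obtain ⟨A', hu, hA'⟩ := ih _ (T.rank_lt h) u rfl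
        refine ⟨insert v A', by simp, fun w hw u' hu' => Finset.mem_insert_of_mem ?_⟩
        rcases Finset.mem_insert.1 hw with rfl | hw
        · rw [h] at hu'
          cases hu'
          exact hu
        · exact hA' w hw u' hu'
  choose f hf hf' using hsingle
  refine ⟨A.biUnion f, fun v hv => Finset.mem_biUnion.2 ⟨v, hv, hf v⟩, fun v hv u hu => ?_⟩
  obtain ⟨w, hw, hvw⟩ := Finset.mem_biUnion.1 hv
  exact Finset.mem_biUnion.2 ⟨w, hw, hf' w v hvw u hu⟩

/-- On a parent-closed set, the configuration is `ζ` iff the coin at every vertex whose parent is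
not occupied in `ζ` shows the value of `ζ`; the other coins are irrelevant. -/
lemma setOf_occupied_eq {A : Finset G} (hA : T.ParentClosed A) {ζ : G → Bool}
    (hζ : T.Independent ζ) :
    {B | ∀ v ∈ A, T.occupied B v = ζ v} =
      Set.pi (A : Set G) fun v => {b | (∀ u, T.par v = some u → ζ u = false) → b = ζ v} := by
  ext B
  constructor
  · intro h v hv hfree
    rw [Bool.eq_iff_iff, ← h v hv, occupied_iff, iff_self_and]
    exact fun _ u hu => by rw [h u (hA v hv u hu), hfree u hu]
  · intro h v hv
    induction hn : T.rank v using Nat.strong_induction_on generalizing v with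
    | _ n ih =>
      subst hn
      have hpar : ∀ u, T.par v = some u → T.occupied B u = ζ u := fun u hu =>
        ih _ (T.rank_lt hu) u (hA v hv u hu) rfl
      rw [Bool.eq_iff_iff, occupied_iff]
      by_cases hfree : ∀ u, T.par v = some u → ζ u = false
      · rw [h v hv hfree, and_iff_left]
        exact fun u hu => by rw [hpar u hu, hfree u hu]
      · push Not at hfree
        obtain ⟨u, hu, hζu⟩ := hfree
        constructor
        · rintro ⟨-, h2⟩
          exact absurd ((hpar u hu).symm.trans (h2 u hu)) hζu
        · exact fun h2 => absurd (hζ v u hu h2) hζu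

/-- The law of a coin with odds `x`. -/
noncomputable def coin (x : ℝ) : Measure Bool :=
  ENNReal.ofReal (x / (1 + x)) • Measure.dirac true
    + ENNReal.ofReal ((1 + x)⁻¹) • Measure.dirac false

lemma isProbabilityMeasure_coin {x : ℝ} (hx : 0 < x) : IsProbabilityMeasure (coin x) := by
  refine ⟨?_⟩
  simp only [coin, Measure.add_apply, Measure.smul_apply, measure_univ, smul_eq_mul, mul_one]
  rw [← ENNReal.ofReal_add (by positivity) (by positivity), ENNReal.ofReal_eq_one]
  field_simp
  ring

lemma coin_real_singleton {x : ℝ} (hx : 0 < x) (b : Bool) :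
    (coin x).real {b} = (1 + x)⁻¹ * if b = true then x else 1 := by
  have h1 : 0 ≤ x / (1 + x) := by positivity
  have h2 : 0 ≤ (1 + x)⁻¹ := by positivity
  cases b
  · simp [coin, measureReal_def, ENNReal.toReal_ofReal h2]
  · simpa [coin, measureReal_def, div_eq_inv_mul] using h1

/-- The law of independent coins with odds `x v` at the vertices `v`. -/
noncomputable def coins (x : G → ℝ) : Measure (G → Bool) :=
  Measure.infinitePi fun v => coin (x v)

lemma isProbabilityMeasure_coins {x : G → ℝ} (hx : ∀ v, 0 < x v) :
    IsProbabilityMeasure (coins x) := by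
  have := fun v => isProbabilityMeasure_coin (hx v)
  unfold coins
  infer_instance

open Classical in
/-- The probability of an independent configuration on a parent-closed set. A vertex whose parent
is occupied contributes `1` instead of `(1 + x v)⁻¹`; this factor `1 + x v` is accounted to the
parent. -/
lemma coins_real_occupied_eq {x : G → ℝ} (hx : ∀ v, 0 < x v) {A : Finset G}
    (hA : T.ParentClosed A) {ζ : G → Bool} (hζ : T.Independent ζ) :
    (coins x).real {B | ∀ v ∈ A, T.occupied B v = ζ v} =
      ∏ v ∈ A, (1 + x v)⁻¹ *
        if ζ v = true then x v * ∏ c ∈ T.children v ∩ A, (1 + x c) else 1 := by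
  have hprob := fun v => isProbabilityMeasure_coin (hx v)
  -- the last product is `1 + x v` if the parent of `v` is occupied, and `1` otherwise
  have hfactor : ∀ v ∈ A,
      (coin (x v)).real {b | (∀ u, T.par v = some u → ζ u = false) → b = ζ v} =
        ((1 + x v)⁻¹ * if ζ v = true then x v else 1) *
          ∏ u ∈ A, if T.par v = some u ∧ ζ u = true then 1 + x v else 1 := by
    intro v hv
    by_cases hfree : ∀ u, T.par v = some u → ζ u = false
    · have : {b | (∀ u, T.par v = some u → ζ u = false) → b = ζ v} = {ζ v} := by
        ext b
        simp only [Set.mem_ofPred_eq, Set.mem_singleton_iff]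
        exact ⟨fun h => h hfree, fun h _ => h⟩
      rw [this, coin_real_singleton (hx v), Finset.prod_eq_one, mul_one]
      intro u _
      rw [if_neg]
      rintro ⟨h1, h2⟩
      simp [hfree u h1] at h2
    · have : {b | (∀ u, T.par v = some u → ζ u = false) → b = ζ v} = Set.univ :=
        Set.eq_univ_of_forall fun b h => absurd h hfree
      push Not at hfree
      obtain ⟨u, hu, hζu⟩ := hfree
      have hζu' : ζ u = true := by simpa using hζu
      have hζv : ζ v ≠ true := fun h => hζu (hζ v u hu h)
      rw [this, probReal_univ, if_neg hζv, Finset.prod_eq_single u, if_pos ⟨hu, hζu'⟩]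
      · have := hx v
        field_simp
      · intro w _ hw
        rw [if_neg]
        rintro ⟨h1, -⟩
        rw [hu] at h1
        exact hw (Option.some.inj h1).symm
      · exact fun h => absurd (hA v hv u hu) h
  -- collecting these factors at the parents
  have hswap : ∏ v ∈ A, ∏ u ∈ A, (if T.par v = some u ∧ ζ u = true then 1 + x v else 1) =
      ∏ v ∈ A, if ζ v = true then ∏ c ∈ T.children v ∩ A, (1 + x c) else 1 := by
    rw [Finset.prod_comm]
    refine Finset.prod_congr rfl fun v _ => ?_
    split_ifs with h
    · simp only [h, and_true]
      rw [← Finset.prod_filter]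
      refine Finset.prod_congr ?_ fun _ _ => rfl
      ext c
      simp [T.mem_children, and_comm]
    · simp [h]
  rw [T.setOf_occupied_eq hA hζ, measureReal_def, coins,
    Measure.infinitePi_pi _ fun v _ => MeasurableSet.of_discrete, ENNReal.toReal_prod]
  simp only [← measureReal_def]
  rw [Finset.prod_congr rfl hfactor, Finset.prod_mul_distrib, hswap, ← Finset.prod_mul_distrib]
  refine Finset.prod_congr rfl fun v _ => ?_
  split_ifs
  · ring
  · ring

end RootedForest

/-! ### Boundary laws of the hard-core model -/

lemma exists_pos_mul_one_add_pow_eq (d : ℕ) {r : ℝ} (hr : 0 < r) :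
    ∃ x : ℝ, 0 < x ∧ x * (1 + x) ^ d = r := by
  have hcont : ContinuousOn (fun x : ℝ => x * (1 + x) ^ d) (Set.Icc 0 r) := by fun_prop
  have hmem : r ∈ Set.Icc ((0 : ℝ) * (1 + 0) ^ d) (r * (1 + r) ^ d) :=
    ⟨by simpa using hr.le, le_mul_of_one_le_right hr.le (one_le_pow₀ (by linarith))⟩
  obtain ⟨x, ⟨hx0, -⟩, hx⟩ := intermediate_value_Icc hr.le hcont hmem
  refine ⟨x, hx0.lt_of_ne fun h => ?_, hx⟩
  subst h
  simp at hx
  exact hr.ne hx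

/-- The critical activity `(d + 1) ^ (d + 1) / d ^ (d + 2)` of the hard-core model on the tree of
degree `d + 2` is smaller than `1` for `d ≥ 4`. -/
lemma one_add_inv_pow_lt {d : ℕ} (hd : 4 ≤ d) : (1 + (d : ℝ)⁻¹) ^ (d + 1) < d := by
  have hd' : (4 : ℝ) ≤ d := by exact_mod_cast hd
  have hd0 : (0 : ℝ) < d := by linarith
  have h1 : (1 + (d : ℝ)⁻¹) ^ (d + 1) ≤ Real.exp 1 * (1 + (d : ℝ)⁻¹) := by
    rw [pow_succ]
    gcongr
    calc (1 + (d : ℝ)⁻¹) ^ d ≤ Real.exp ((d : ℝ)⁻¹) ^ d := by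
          gcongr
          linarith [Real.add_one_le_exp ((d : ℝ)⁻¹)]
      _ = Real.exp 1 := by rw [← Real.exp_nat_mul, mul_inv_cancel₀ hd0.ne']
  have h2 : (d : ℝ)⁻¹ ≤ 4⁻¹ := inv_anti₀ (by norm_num) hd'
  nlinarith [Real.exp_one_lt_d9, Real.exp_pos 1]

/-- For an activity at least `1` on the tree of degree at least `6`, the equations for a boundary
law that alternates between the levels have a solution that is not constant. With `t` the ratio of
`1 + y` and `1 + z` and `S = 1 + t + ⋯ + t ^ (d - 2)`, the solutions for all activities are
`y = t ^ (d - 1) / S` and `z = 1 / (t * S)`; the activity is a continuous function of `t`, tends to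
infinity with `t`, and at `t = 1` is the critical activity. -/
lemma exists_ne_mul_one_add_pow_eq {d : ℕ} (hd : 5 ≤ d) {r : ℝ} (hr : 1 ≤ r) :
    ∃ y z : ℝ, 0 < y ∧ 0 < z ∧ y ≠ z ∧ y * (1 + z) ^ d = r ∧ z * (1 + y) ^ d = r := by
  obtain ⟨k, rfl⟩ : ∃ k, d = k + 1 := ⟨d - 1, by omega⟩
  have hk : 4 ≤ k := by omega
  have hk' : (4 : ℝ) ≤ k := by exact_mod_cast hk
  let S : ℝ → ℝ := fun t => ∑ i ∈ Finset.range k, t ^ i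
  have hS : ∀ t, 1 ≤ t → 1 ≤ S t := fun t ht => by
    obtain ⟨j, rfl⟩ : ∃ j, k = j + 1 := ⟨k - 1, by omega⟩
    simp only [S, Finset.sum_range_succ']
    have : 0 ≤ ∑ i ∈ Finset.range j, t ^ (i + 1) :=
      Finset.sum_nonneg fun i _ => by positivity
    simpa using this
  have hS_le : ∀ t, 1 ≤ t → S t ≤ k * t ^ (k - 1) := fun t ht => by
    refine (Finset.sum_le_card_nsmul _ _ (t ^ (k - 1)) fun i hi => ?_).trans (by simp)
    exact pow_le_pow_right₀ ht (by have := Finset.mem_range.1 hi; omega)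
  have hgeom : ∀ t, 1 + t * S t = S t + t ^ k := fun t => by
    have h1 := Finset.sum_range_succ (fun i => t ^ i) k
    have h2 := Finset.sum_range_succ' (fun i => t ^ i) k
    simp only [S, Finset.mul_sum]
    rw [← h1, h2]
    simp [pow_succ', add_comm]
  let y : ℝ → ℝ := fun t => t ^ k / S t
  let z : ℝ → ℝ := fun t => 1 / (t * S t)
  have hcont : ContinuousOn (fun t => y t * (1 + z t) ^ (k + 1)) (Set.Icc 1 (k * r)) := by
    have hS0 : ∀ t ∈ Set.Icc 1 (k * r), S t ≠ 0 := fun t ht => by linarith [hS t ht.1]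
    have hS1 : ∀ t ∈ Set.Icc 1 (k * r), t * S t ≠ 0 := fun t ht =>
      mul_ne_zero (by linarith [ht.1]) (hS0 t ht)
    have hSc : Continuous S := by fun_prop
    exact ((continuous_pow k).continuousOn.div hSc.continuousOn hS0).mul
      ((continuousOn_const.add (continuousOn_const.div
        (continuous_id.mul hSc).continuousOn hS1)).pow _)
  have hS_one : S 1 = k := by simp [S]
  -- the solution at `t = 1` belongs to the critical activity
  have hone : y 1 * (1 + z 1) ^ (k + 1) < 1 := by
    simp only [y, z, hS_one, one_pow, one_mul, one_div]
    rw [inv_mul_lt_one₀ (by linarith)]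
    exact one_add_inv_pow_lt hk
  have hkr : 1 ≤ k * r := by nlinarith
  -- as `S t ≤ k * t ^ (k - 1)`, already `y t ≥ t / k`, which is `r` at `t = k * r`
  have hlarge : r ≤ y (k * r) * (1 + z (k * r)) ^ (k + 1) := by
    have hS' := hS _ hkr
    have hz : 0 < z (k * r) := by
      have : 0 < (k * r) * S (k * r) := by nlinarith
      exact one_div_pos.2 this
    have hy : r ≤ y (k * r) := by
      simp only [y]
      rw [le_div_iff₀ (by linarith)]
      calc r * S (k * r) ≤ r * (k * (k * r) ^ (k - 1)) := by
            gcongr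
            exact hS_le _ hkr
        _ = (k * r) ^ k := by
            conv_rhs => rw [show k = (k - 1) + 1 by omega, pow_succ]
            rw [show k - 1 + 1 = k by omega]
            ring
    exact hy.trans (le_mul_of_one_le_right (by linarith) (one_le_pow₀ (by linarith)))
  obtain ⟨t, ⟨ht1, -⟩, ht⟩ := intermediate_value_Icc hkr hcont ⟨hone.le.trans hr, hlarge⟩
  simp only at ht
  have ht1' : 1 < t := ht1.lt_of_ne fun h => by
    subst h
    linarith
  have hS' := hS t ht1
  have hS0 : S t ≠ 0 := by linarith
  have ht0 : 0 < t := by linarith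
  have hz : 0 < z t := one_div_pos.2 (by nlinarith)
  have hyz : y t = t ^ (k + 1) * z t := by
    simp only [y, z, pow_succ]
    field_simp
  have hratio : 1 + y t = t * (1 + z t) := by
    have := hgeom t
    simp only [y, z]
    field_simp
    linarith
  have hy : z t < y t := by
    rw [hyz]
    exact lt_mul_of_one_lt_left hz (one_lt_pow₀ ht1' (by omega))
  refine ⟨y t, z t, hz.trans hy, hz, hy.ne', ht, ?_⟩
  rw [← ht, hratio, mul_pow, hyz]
  ring

/-! ### The target structure and its dismantling -/

/-- The edges of the hard-core constraint with occupied letter `i` and empty letter `i + 1`. -/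
def HardCoreEdge (i a b : Fin 3) : Prop :=
  (a = i ∨ a = i + 1) ∧ (b = i ∨ b = i + 1) ∧ ¬(a = i ∧ b = i)

instance (i a b : Fin 3) : Decidable (HardCoreEdge i a b) := by
  unfold HardCoreEdge
  infer_instance

/-- Three letters in cyclic order; the `i`-th relation is the hard-core constraint with occupied
letter `i` and empty letter `i + 1`. -/
instance cyclicHardCore : threeBinary.Structure (Fin 3) where
  funMap f := Empty.elim f
  RelMap R :=
    match R with
    | ThreeBinaryRel.R i => fun x : Fin 2 → Fin 3 => HardCoreEdge i (x 0) (x 1)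

lemma hardCoreEdge_comm {i a b : Fin 3} : HardCoreEdge i a b ↔ HardCoreEdge i b a := by
  unfold HardCoreEdge
  tauto

/-- The one of two distinct letters that follows the other one in the cyclic order. -/
def follower (p : Fin 3 × Fin 3) : Fin 3 := if p.2 = p.1 + 1 then p.2 else p.1

/-- The two letters of an off-diagonal pair both have neighbours only in the relation in which the
preceding letter is the occupied one, and there the empty letter dominates. -/
lemma hardCoreEdge_follower : ∀ (i : Fin 3) (p q : Fin 3 × Fin 3), p.1 ≠ p.2 →
    HardCoreEdge i p.1 q.1 → HardCoreEdge i p.2 q.2 →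
      HardCoreEdge i (follower p) q.1 ∧ HardCoreEdge i (follower p) q.2 := by
  decide

lemma dominatesIn_follower (S : Set (Fin 3 × Fin 3)) (p : Fin 3 × Fin 3) (hp : p.1 ≠ p.2) :
    DominatesIn threeBinary S (follower p, follower p) p := by
  rintro _ ⟨k⟩ x - ⟨h1, h2⟩ i hi
  change HardCoreEdge k (x 0).1 (x 1).1 at h1
  change HardCoreEdge k (x 0).2 (x 1).2 at h2
  change HardCoreEdge k _ _ ∧ HardCoreEdge k _ _
  match i, hi with
  | 0, hi =>
    subst hi
    simpa using hardCoreEdge_follower k (x 0) (x 1) hp h1 h2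
  | 1, hi =>
    subst hi
    rw [hardCoreEdge_comm] at h1 h2
    simp only [Function.update_self, ne_eq, zero_ne_one, not_false_eq_true,
      Function.update_of_ne]
    rw [hardCoreEdge_comm, hardCoreEdge_comm (b := follower _)]
    exact hardCoreEdge_follower k (x 1) (x 0) hp h1 h2

lemma dismantlesTo_diagonal :
    DismantlesTo threeBinary (Fin 3 × Fin 3) (Set.diagonal (Fin 3)) := by
  -- the dominating pairs are diagonal, so the others can be removed in any order
  have key : ∀ s : Finset (Fin 3 × Fin 3), (∀ p ∈ s, p.1 ≠ p.2) →
      DismantlesTo threeBinary (Fin 3 × Fin 3) (Set.univ \ (s : Set (Fin 3 × Fin 3))) := by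
    intro s
    induction s using Finset.induction_on with
    | empty =>
      intro _
      rw [Finset.coe_empty, Set.sdiff_empty]
      exact .refl
    | insert p s hps ih =>
      intro h
      refine (ih fun q hq => h q (Finset.mem_insert_of_mem hq)).tail ?_
      have hp := h p (Finset.mem_insert_self _ _)
      refine ⟨p, by simpa using hps, (follower p, follower p), ?_, ?_,
        dominatesIn_follower _ p hp, ?_⟩
      · refine ⟨trivial, fun hmem => h _ (Finset.mem_insert_of_mem hmem) rfl⟩
      · intro heq
        exact hp ((congrArg Prod.fst heq).trans (congrArg Prod.snd heq).symm)
      · ext q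
        simp [not_or, and_comm]
  have := key (Finset.univ.filter fun p => p.1 ≠ p.2) (by simp)
  convert this using 1
  ext p
  simp

/-! ### Rooted forests as graphs and their three copies -/

namespace ThreeCopies

variable {V : Type} {T : SimpleGraph V}

/-- The index of the copy in which a vertex lies. -/
def copy (p : ThreeCopies T) : Fin 3 := Prod.fst (α := Fin 3) (β := V) p

/-- The vertex of `T` of which a vertex is a copy. -/
def vertex (p : ThreeCopies T) : V := Prod.snd (α := Fin 3) (β := V) p

variable (T) in
/-- The vertex `v` in the `i`-th copy. -/
def mk (i : Fin 3) (v : V) : ThreeCopies T := Prod.mk (α := Fin 3) (β := V) i v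

@[simp] lemma copy_mk (i : Fin 3) (v : V) : (mk T i v).copy = i := rfl

@[simp] lemma vertex_mk (i : Fin 3) (v : V) : (mk T i v).vertex = v := rfl

@[simp] lemma mk_copy_vertex (p : ThreeCopies T) : mk T p.copy p.vertex = p := rfl

lemma mk_eq_iff {i : Fin 3} {v : V} {p : ThreeCopies T} :
    mk T i v = p ↔ i = p.copy ∧ v = p.vertex :=
  ⟨by rintro rfl; exact ⟨rfl, rfl⟩, by rintro ⟨rfl, rfl⟩; rfl⟩

lemma mk_injective (i : Fin 3) : Function.Injective (mk T i) := fun _ _ h =>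
  (mk_eq_iff.1 h).2

end ThreeCopies

namespace RootedForest

variable {V : Type} (T : RootedForest V)

/-- The graph that joins every vertex to its parent. -/
def graph : SimpleGraph V where
  Adj u v := T.par u = some v ∨ T.par v = some u
  symm := ⟨fun _ _ h => h.symm⟩
  loopless := ⟨fun _ h => (lt_irrefl _ (T.rank_lt (h.elim id id)))⟩

lemma graph_adj {u v : V} : T.graph.Adj u v ↔ T.par u = some v ∨ T.par v = some u := Iff.rfl

/-- A rooted forest with a single root is a tree: the edge from `v` to its parent is the only one
that leaves the set of descendants of `v`, hence a bridge. -/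
lemma isTree_graph (r : V) (hr : ∀ v, T.par v = none → v = r) : T.graph.IsTree := by
  have hreach : ∀ v, T.graph.Reachable v r := by
    intro v
    induction hn : T.rank v using Nat.strong_induction_on generalizing v with
    | _ n ih =>
      subst hn
      rcases h : T.par v with _ | u
      · rw [hr v h]
      · have hadj : T.graph.Adj v u := Or.inl h
        exact hadj.reachable.trans (ih _ (T.rank_lt h) u rfl)
  have : Nonempty V := ⟨r⟩
  refine ⟨⟨fun u v => (hreach u).trans (hreach v).symm⟩, ?_⟩
  have hbridge : ∀ v u, T.par v = some u → T.graph.IsBridge s(v, u) := by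
    intro v u h
    rw [SimpleGraph.isBridge_iff]
    refine fun hvu => ?_
    have hD : ∀ w, (T.graph \ SimpleGraph.fromEdgeSet {s(v, u)}).Reachable v w →
        Relation.ReflTransGen (fun a b => T.par a = some b) w v := by
      intro w hw
      rw [SimpleGraph.reachable_iff_reflTransGen] at hw
      induction hw with
      | refl => exact .refl
      | @tail a b _ hab ih =>
        obtain ⟨hadj | hadj, hne⟩ := hab
        · rcases ih.cases_head with rfl | ⟨c, hac, hcv⟩
          · rw [h] at hadj
            cases hadj
            exact absurd ⟨rfl, fun e => by subst e; exact lt_irrefl _ (T.rank_lt h)⟩ hne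
          · rw [hac] at hadj
            cases hadj
            exact hcv
        · exact ih.head hadj
    have hrank : ∀ a b, Relation.ReflTransGen (fun a b => T.par a = some b) a b →
        T.rank b ≤ T.rank a := by
      intro a b hab
      induction hab with
      | refl => exact le_rfl
      | tail _ hbc ih => exact (T.rank_lt hbc).le.trans ih
    exact absurd (hrank _ _ (hD u hvu)) (not_le.2 (T.rank_lt h))
  rw [SimpleGraph.isAcyclic_iff_forall_adj_isBridge]
  rintro v u (h | h)
  · exact hbridge v u h
  · rw [Sym2.eq_swap]
    exact hbridge u v h

lemma degree_graph [T.graph.LocallyFinite] (v : V) :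
    T.graph.degree v = (T.children v).card + (T.par v).toFinset.card := by
  classical
  rw [← Finset.card_union_of_disjoint, ← SimpleGraph.card_neighborFinset_eq_degree]
  · congr 1
    ext u
    simp [graph_adj, T.mem_children, or_comm]
  · rw [Finset.disjoint_left]
    intro u h1 h2
    rw [T.mem_children] at h1
    rw [Option.mem_toFinset, Option.mem_def] at h2
    exact lt_asymm (T.rank_lt h1) (T.rank_lt h2)

/-- The disjoint union of three copies of a rooted forest. -/
def copies : RootedForest (ThreeCopies T.graph) where
  par p := (T.par p.vertex).map (ThreeCopies.mk T.graph p.copy)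
  rank p := T.rank p.vertex
  rank_lt := by
    intro p q h
    obtain ⟨w, hw, rfl⟩ := Option.map_eq_some_iff.1 h
    exact T.rank_lt hw
  children p := (T.children p.vertex).map
    ⟨ThreeCopies.mk T.graph p.copy, ThreeCopies.mk_injective p.copy⟩
  mem_children := by
    intro c p
    simp only [Finset.mem_map, T.mem_children, Function.Embedding.coeFn_mk,
      Option.map_eq_some_iff, ThreeCopies.mk_eq_iff]
    constructor
    · rintro ⟨w, h, hc, rfl⟩
      exact ⟨_, h, hc.symm, rfl⟩
    · rintro ⟨w, h, hc, rfl⟩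
      exact ⟨_, h, hc.symm, rfl⟩

lemma copies_par_eq_some {p q : ThreeCopies T.graph} :
    T.copies.par p = some q ↔ p.copy = q.copy ∧ T.par p.vertex = some q.vertex := by
  simp only [copies, Option.map_eq_some_iff, ThreeCopies.mk_eq_iff]
  constructor
  · rintro ⟨u, h, hc, rfl⟩
    exact ⟨hc, h⟩
  · rintro ⟨hc, h⟩
    exact ⟨_, h, hc, rfl⟩

/-- An independent configuration as a homomorphism: in the `i`-th copy the occupied vertices go
to `i` and the empty ones to `i + 1`. -/
def toHom (ζ : ThreeCopies T.graph → Bool) (hζ : T.copies.Independent ζ) :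
    ThreeCopies T.graph →[threeBinary] Fin 3 where
  toFun v := if ζ v = true then v.copy else v.copy + 1
  map_fun' f := Empty.elim f
  map_rel' := by
    rintro _ ⟨i⟩ x ⟨(h0 : (x 0).copy = i), (h1 : (x 1).copy = i), hadj⟩
    change HardCoreEdge i (if ζ (x 0) = true then (x 0).copy else (x 0).copy + 1)
      (if ζ (x 1) = true then (x 1).copy else (x 1).copy + 1)
    have hnot : ¬(ζ (x 0) = true ∧ ζ (x 1) = true) := by
      rintro ⟨z0, z1⟩
      rcases hadj with h | h
      · have := hζ (x 0) (x 1) (T.copies_par_eq_some.2 ⟨h0.trans h1.symm, h⟩) z0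
        simp [this] at z1
      · have := hζ (x 1) (x 0) (T.copies_par_eq_some.2 ⟨h1.trans h0.symm, h⟩) z1
        simp [this] at z0
    rw [h0, h1]
    unfold HardCoreEdge
    split_ifs <;> simp_all

lemma toHom_apply (ζ : ThreeCopies T.graph → Bool) (hζ : T.copies.Independent ζ)
    (v : ThreeCopies T.graph) :
    T.toHom ζ hζ v = if ζ v = true then v.copy else v.copy + 1 := rfl

lemma hom_edge (χ : ThreeCopies T.graph →[threeBinary] Fin 3) {p q : ThreeCopies T.graph}
    (hc : p.copy = q.copy) (h : T.graph.Adj p.vertex q.vertex) :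
    HardCoreEdge p.copy (χ p) (χ q) :=
  χ.map_rel (ThreeBinaryRel.R p.copy : threeBinary.Relations 2) ![p, q] ⟨rfl, hc.symm, h⟩

/-- Without isolated vertices, each vertex of the `i`-th copy goes to `i` or to `i + 1`. -/
lemma hom_apply_eq_or (hT : ∀ v, ∃ u, T.graph.Adj v u)
    (χ : ThreeCopies T.graph →[threeBinary] Fin 3) (v : ThreeCopies T.graph) :
    χ v = v.copy ∨ χ v = v.copy + 1 := by
  obtain ⟨u, hu⟩ := hT v.vertex
  exact (T.hom_edge χ (p := v) (q := ThreeCopies.mk T.graph v.copy u) rfl hu).1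

/-- The set of vertices that a homomorphism occupies. -/
def occupation (χ : ThreeCopies T.graph →[threeBinary] Fin 3) (v : ThreeCopies T.graph) : Bool :=
  decide (χ v = v.copy)

lemma independent_occupation (χ : ThreeCopies T.graph →[threeBinary] Fin 3) :
    T.copies.Independent (T.occupation χ) := by
  intro v u h hv
  obtain ⟨hc, h⟩ := T.copies_par_eq_some.1 h
  have := (T.hom_edge χ hc (Or.inl h)).2.2
  simp only [occupation, decide_eq_true_eq, decide_eq_false_iff_not] at hv ⊢
  exact fun hu => this ⟨hv, hu.trans hc.symm⟩

lemma toHom_apply_eq_iff (hT : ∀ v, ∃ u, T.graph.Adj v u) (ζ : ThreeCopies T.graph → Bool)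
    (hζ : T.copies.Independent ζ) (χ : ThreeCopies T.graph →[threeBinary] Fin 3)
    (v : ThreeCopies T.graph) : T.toHom ζ hζ v = χ v ↔ ζ v = T.occupation χ v := by
  rw [toHom_apply]
  rcases T.hom_apply_eq_or hT χ v with h | h <;> cases hζv : ζ v <;>
    simp [occupation, h]

/-- The law of the random homomorphism whose occupied vertices are obtained from independent coins
with odds `x`. -/
noncomputable def homMeasure (x : ThreeCopies T.graph → ℝ) :
    Measure (ThreeCopies T.graph →[threeBinary] Fin 3) :=
  (coins x).map fun B => T.toHom (T.copies.occupied B) (T.copies.independent_occupied B)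

lemma preimage_agreeOn (hT : ∀ v, ∃ u, T.graph.Adj v u)
    (χ : ThreeCopies T.graph →[threeBinary] Fin 3) (A : Finset (ThreeCopies T.graph)) :
    (fun B => T.toHom (T.copies.occupied B) (T.copies.independent_occupied B)) ⁻¹'
        agreeOn χ (A : Set (ThreeCopies T.graph)) =
      {B | ∀ v ∈ A, T.copies.occupied B v = T.occupation χ v} := by
  ext B
  exact forall₂_congr fun v _ => T.toHom_apply_eq_iff hT _ _ χ v

lemma measurable_toHom_occupied (hT : ∀ v, ∃ u, T.graph.Adj v u) :
    Measurable fun B => T.toHom (T.copies.occupied B) (T.copies.independent_occupied B) := by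
  refine measurable_generateFrom ?_
  rintro _ ⟨χ, A, -, rfl⟩
  rw [T.preimage_agreeOn hT χ A]
  have : {B | ∀ v ∈ A, T.copies.occupied B v = T.occupation χ v} =
      ⋂ v ∈ A, (fun B => T.copies.occupied B v) ⁻¹' {T.occupation χ v} := by
    ext B
    simp
  rw [this]
  exact Finset.measurableSet_biInter _ fun v _ =>
    T.copies.measurable_occupied v (measurableSet_singleton _)

lemma isProbabilityMeasure_homMeasure (hT : ∀ v, ∃ u, T.graph.Adj v u)
    {x : ThreeCopies T.graph → ℝ} (hx : ∀ v, 0 < x v) :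
    IsProbabilityMeasure (T.homMeasure x) := by
  have := isProbabilityMeasure_coins hx
  exact Measure.isProbabilityMeasure_map (T.measurable_toHom_occupied hT).aemeasurable

open Classical in
lemma homMeasure_real_agreeOn (hT : ∀ v, ∃ u, T.graph.Adj v u) {x : ThreeCopies T.graph → ℝ}
    (hx : ∀ v, 0 < x v) {A : Finset (ThreeCopies T.graph)} (hA : T.copies.ParentClosed A)
    (χ : ThreeCopies T.graph →[threeBinary] Fin 3) :
    (T.homMeasure x).real (agreeOn χ (A : Set (ThreeCopies T.graph))) =
      ∏ v ∈ A, (1 + x v)⁻¹ *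
        if χ v = v.copy then x v * ∏ c ∈ T.copies.children v ∩ A, (1 + x c) else 1 := by
  rw [homMeasure, map_measureReal_apply (T.measurable_toHom_occupied hT)
    (measurableSet_agreeOn χ A (Set.subset_univ _)), T.preimage_agreeOn hT,
    T.copies.coins_real_occupied_eq hx hA (T.independent_occupation χ)]
  simp only [occupation, decide_eq_true_eq]

/-- If the odds satisfy the equations of a boundary law, then on a parent-closed set each vertex
whose children all belong to the set contributes a factor proportional to its weight, so that the
criterion `isGibbs_of_product_form` applies. -/
theorem isGibbs_homMeasure (hT : ∀ v, ∃ u, T.graph.Adj v u) {x : ThreeCopies T.graph → ℝ}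
    (hx : ∀ v, 0 < x v) {lam : Fin 3 → ℝ} (hlam : ∀ a, 0 < lam a)
    (hlaw : ∀ v, x v * ∏ c ∈ T.copies.children v, (1 + x c) =
      lam v.copy / lam (v.copy + 1)) :
    IsGibbs lam (T.homMeasure x) := by
  classical
  have := T.isProbabilityMeasure_homMeasure hT hx
  refine isGibbs_of_product_form hlam _ fun A W => ?_
  obtain ⟨F, hF, hclosed⟩ :=
    T.copies.exists_parentClosed_superset (A ∪ W ∪ A.biUnion T.copies.children)
  have hAF : A ⊆ F := fun v hv => hF (by simp [hv])
  have hchild : ∀ v ∈ A, T.copies.children v ⊆ F := fun v hv c hc =>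
    hF (Finset.mem_union_right _ (Finset.mem_biUnion.2 ⟨v, hv, hc⟩))
  refine ⟨F, ⟨hAF, ?_⟩, fun v hv => hF (by simp [hv]),
    fun v a =>
      (1 + x v)⁻¹ * if a = v.copy then x v * ∏ c ∈ T.copies.children v ∩ F, (1 + x c) else 1,
    fun v => (1 + x v)⁻¹ * (lam (v.copy + 1))⁻¹,
    fun χ => T.homMeasure_real_agreeOn hT hx hclosed χ, ?_⟩
  · have hnbr : ∀ p q : ThreeCopies T.graph, p.copy = q.copy →
        T.graph.Adj p.vertex q.vertex → p ∈ A → q ∈ F := by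
      rintro p q h (hadj | hadj) hp
      · exact hclosed p (hAF hp) q (T.copies_par_eq_some.2 ⟨h, hadj⟩)
      · exact hchild p hp (T.copies.mem_children.2 (T.copies_par_eq_some.2 ⟨h.symm, hadj⟩))
    rintro _ ⟨k⟩ t ⟨(h0 : (t 0).copy = k), (h1 : (t 1).copy = k), hadj⟩ ⟨i, hi⟩ j
    have h01 := h0.trans h1.symm
    match i, hi, j with
    | 0, hi, 0 => exact hAF hi
    | 1, hi, 1 => exact hAF hi
    | 0, hi, 1 => exact hnbr _ _ h01 hadj hi
    | 1, hi, 0 => exact hnbr _ _ h01.symm hadj.symm hi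
  · intro χ v hv
    have hne := (hlam (v.copy + 1)).ne'
    simp only [Finset.inter_eq_left.2 (hchild _ hv), hlaw]
    rcases T.hom_apply_eq_or hT χ v with h | h
    · rw [if_pos h, h]
      ring
    · rw [if_neg (by simp [h]), h]
      field_simp

end RootedForest

lemma boundedDegree_threeCopies {V : Type} (T : SimpleGraph V) [T.LocallyFinite] {Δ : ℕ}
    (hT : T.IsRegularOfDegree Δ) : BoundedDegree threeBinary (ThreeCopies T) := by
  refine ⟨2 * Δ, fun p => ?_⟩
  let f : Bool × T.neighborSet p.vertex →
      Σ n : ℕ, threeBinary.Relations n × (Fin n → ThreeCopies T) := fun s =>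
    ⟨2, ThreeBinaryRel.R p.copy, if s.1 = true then ![p, ThreeCopies.mk T p.copy s.2]
      else ![ThreeCopies.mk T p.copy s.2, p]⟩
  have hsub : tuplesThrough threeBinary p ⊆ f '' Set.univ := by
    rintro ⟨_, ⟨k⟩, t⟩ ⟨⟨(h0 : (t 0).copy = k), (h1 : (t 1).copy = k), hadj⟩, j, hj⟩
    have h01 := h0.trans h1.symm
    match j, hj with
    | 0, hj =>
      change t 0 = p at hj
      subst hj
      refine ⟨(true, ⟨(t 1).vertex, hadj⟩), trivial, ?_⟩
      have : ![t 0, ThreeCopies.mk T (t 0).copy (t 1).vertex] = t := by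
        funext i
        match i with
        | 0 => rfl
        | 1 => exact ThreeCopies.mk_eq_iff.2 ⟨h01, rfl⟩
      simp only [f, if_true]
      rw [this, h0]
    | 1, hj =>
      change t 1 = p at hj
      subst hj
      refine ⟨(false, ⟨(t 0).vertex, hadj.symm⟩), trivial, ?_⟩
      have : ![ThreeCopies.mk T (t 1).copy (t 0).vertex, t 1] = t := by
        funext i
        match i with
        | 0 => exact ThreeCopies.mk_eq_iff.2 ⟨h01.symm, rfl⟩
        | 1 => rfl
      simp only [f, Bool.false_eq_true, if_false]
      rw [this, h1]
  calc (tuplesThrough threeBinary p).encard ≤ (f '' Set.univ).encard :=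
        Set.encard_le_encard hsub
    _ ≤ (Set.univ : Set (Bool × T.neighborSet p.vertex)).encard := Set.encard_image_le _ _
    _ = ((2 * Δ : ℕ) : ℕ∞) := by
        rw [Set.encard_univ, ENat.card_eq_coe_fintype_card, Fintype.card_prod, Fintype.card_bool,
          SimpleGraph.card_neighborSet_eq_degree, hT.degree_eq]

/-! ### The regular tree and its boundary laws -/

/-- The vertices of the regular tree of degree `d + 1`: the root `none`, and for each of the
`d + 1` subtrees at the root the words over `d` letters, which are extended at the front. -/
abbrev TreeVertex (d : ℕ) : Type := Option (Fin (d + 1) × List (Fin d))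

/-- The children of the root. -/
def rootChild (d : ℕ) : Fin (d + 1) ↪ TreeVertex d :=
  ⟨fun a => some (a, []), fun a b h => by simpa using h⟩

/-- The children of the vertex `some (a, l)`. -/
def innerChild {d : ℕ} (a : Fin (d + 1)) (l : List (Fin d)) : Fin d ↪ TreeVertex d :=
  ⟨fun c => some (a, c :: l), fun b c h => by simpa using h⟩

@[simp] lemma rootChild_apply {d : ℕ} (a : Fin (d + 1)) : rootChild d a = some (a, []) := rfl

@[simp] lemma innerChild_apply {d : ℕ} (a : Fin (d + 1)) (l : List (Fin d)) (c : Fin d) :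
    innerChild a l c = some (a, c :: l) := rfl

/-- The regular tree of degree `d + 1`, rooted at `none`. -/
def regularTree (d : ℕ) : RootedForest (TreeVertex d) where
  par
    | none => none
    | some (_, []) => some none
    | some (a, _ :: l) => some (some (a, l))
  rank
    | none => 0
    | some (_, l) => l.length + 1
  rank_lt := by
    rintro (_ | ⟨a, _ | ⟨c, l⟩⟩) u h <;> cases h <;> simp
  children
    | none => Finset.univ.map (rootChild d)
    | some (a, l) => Finset.univ.map (innerChild a l)
  mem_children := by
    rintro (_ | ⟨a, _ | ⟨c, l⟩⟩) (_ | ⟨b, m⟩) <;> simp [eq_comm]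

lemma regularTree_adj_exists {d : ℕ} (hd : 0 < d) (v : TreeVertex d) :
    ∃ u, (regularTree d).graph.Adj v u := by
  rcases v with _ | ⟨a, l⟩
  · exact ⟨some (0, []), Or.inr rfl⟩
  · exact ⟨some (a, ⟨0, hd⟩ :: l), Or.inr rfl⟩

lemma isTree_regularTree (d : ℕ) : (regularTree d).graph.IsTree := by
  refine (regularTree d).isTree_graph none ?_
  rintro (_ | ⟨a, _ | ⟨c, l⟩⟩) h
  · rfl
  · cases h
  · cases h

lemma isRegularOfDegree_regularTree (d : ℕ) [(regularTree d).graph.LocallyFinite] :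
    (regularTree d).graph.IsRegularOfDegree (d + 1) := by
  intro v
  rw [RootedForest.degree_graph]
  rcases v with _ | ⟨a, _ | ⟨c, l⟩⟩ <;> simp [regularTree]

/-- Odds on the three trees that depend on the copy `i` and on the level: `y i` at odd and `z i` at
even levels, and at the root, which has one child more, the value that the equation of the boundary
law with activity `r i` prescribes. A word `l` stands at level `l.length + 1`. -/
noncomputable def levelOdds (d : ℕ) (r y z : Fin 3 → ℝ)
    (p : ThreeCopies (regularTree d).graph) : ℝ :=
  match p.vertex with
  | none => r p.copy / (1 + y p.copy) ^ (d + 1)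
  | some (_, l) => if Even l.length then y p.copy else z p.copy

lemma levelOdds_pos (d : ℕ) {r y z : Fin 3 → ℝ} (hr : ∀ i, 0 < r i) (hy : ∀ i, 0 < y i)
    (hz : ∀ i, 0 < z i) (p : ThreeCopies (regularTree d).graph) : 0 < levelOdds d r y z p := by
  have h1 := hr p.copy
  have h2 := hy p.copy
  have h3 := hz p.copy
  unfold levelOdds
  split
  · positivity
  · split_ifs <;> assumption

lemma levelOdds_boundaryLaw (d : ℕ) {r y z : Fin 3 → ℝ} (hy : ∀ i, 0 < y i)
    (hyz : ∀ i, y i * (1 + z i) ^ d = r i) (hzy : ∀ i, z i * (1 + y i) ^ d = r i)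
    (p : ThreeCopies (regularTree d).graph) :
    levelOdds d r y z p * ∏ c ∈ (regularTree d).copies.children p, (1 + levelOdds d r y z c) =
      r p.copy := by
  have hy' := hy p.copy
  rw [← ThreeCopies.mk_copy_vertex p]
  generalize p.copy = i at *
  rcases p.vertex with _ | ⟨a, l⟩
  · simp [levelOdds, RootedForest.copies, regularTree]
    field_simp
  · by_cases hl : Even l.length
    · simpa [levelOdds, RootedForest.copies, regularTree, hl, Nat.even_add_one] using hyz i
    · simpa [levelOdds, RootedForest.copies, regularTree, hl, Nat.even_add_one] using hzy i

/-! ### Two Gibbs measures -/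

/-- The probability that the root of a copy is empty recovers the odds at the root, and hence the
value `y` of the boundary law at the odd levels. -/
lemma homMeasure_levelOdds_ne {d : ℕ} (hd : 0 < d) {r y z y' z' : Fin 3 → ℝ}
    (hr : ∀ i, 0 < r i) (hy : ∀ i, 0 < y i) (hz : ∀ i, 0 < z i) (hy' : ∀ i, 0 < y' i)
    (hz' : ∀ i, 0 < z' i) {i : Fin 3} (hne : y i ≠ y' i) :
    (regularTree d).homMeasure (levelOdds d r y z) ≠
      (regularTree d).homMeasure (levelOdds d r y' z') := by
  intro h
  let root : ThreeCopies (regularTree d).graph := ThreeCopies.mk _ i none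
  have hclosed : (regularTree d).copies.ParentClosed {root} := by
    intro v hv u hu
    rw [Finset.mem_singleton.1 hv] at hu
    cases hu
  let χ := (regularTree d).toHom (fun _ => false) (fun _ _ _ _ => rfl)
  have hχ : χ root ≠ root.copy := by
    change i + 1 ≠ i
    simp
  have hroot : ∀ y z : Fin 3 → ℝ, (∀ i, 0 < y i) → (∀ i, 0 < z i) →
      ((regularTree d).homMeasure (levelOdds d r y z)).real
        (agreeOn χ (({root} : Finset _) : Set (ThreeCopies (regularTree d).graph))) =
          (1 + r i / (1 + y i) ^ (d + 1))⁻¹ := by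
    intro y z hy hz
    rw [RootedForest.homMeasure_real_agreeOn _ (regularTree_adj_exists hd)
      (levelOdds_pos d hr hy hz) hclosed, Finset.prod_singleton, if_neg hχ, mul_one]
    rfl
  have heq := hroot y z hy hz
  rw [h, hroot y' z' hy' hz', inv_inj, add_right_inj, div_eq_mul_inv,
    div_eq_mul_inv, mul_right_inj' (hr i).ne', inv_inj] at heq
  have h1 := hy i
  have h2 := hy' i
  have := (pow_left_inj₀ (by positivity) (by positivity) (Nat.succ_ne_zero d)).1 heq
  exact hne (by linarith)

/-- In one of the copies the ratio of the weights of the occupied and of the empty letter is at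
least `1`, since the product of the three ratios is `1`; there the boundary law can alternate. -/
theorem exists_isGibbs_ne {d : ℕ} (hd : 5 ≤ d) {lam : Fin 3 → ℝ} (hlam : ∀ a, 0 < lam a) :
    ∃ μ ν : Measure (ThreeCopies (regularTree d).graph →[threeBinary] Fin 3),
      μ ≠ ν ∧ IsGibbs lam μ ∧ IsGibbs lam ν := by
  have hd0 : 0 < d := by omega
  set r : Fin 3 → ℝ := fun i => lam i / lam (i + 1) with hr_def
  have hr : ∀ i, 0 < r i := fun i => div_pos (hlam _) (hlam _)
  obtain ⟨i₀, hi₀⟩ : ∃ i, 1 ≤ r i := by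
    by_contra! hlt
    have h : ∀ i, lam i < lam (i + 1) := fun i => (div_lt_one (hlam _)).1 (hlt i)
    exact lt_irrefl _ (((h 0).trans (h 1)).trans (h 2))
  have hsol : ∀ i, ∃ y z : ℝ, 0 < y ∧ 0 < z ∧ (i = i₀ → y ≠ z) ∧
      y * (1 + z) ^ d = r i ∧ z * (1 + y) ^ d = r i := by
    intro i
    by_cases hi : i = i₀
    · obtain ⟨y, z, hy, hz, hne, h1, h2⟩ := exists_ne_mul_one_add_pow_eq hd (hi ▸ hi₀)
      exact ⟨y, z, hy, hz, fun _ => hne, h1, h2⟩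
    · obtain ⟨x, hx, h⟩ := exists_pos_mul_one_add_pow_eq d (hr i)
      exact ⟨x, x, hx, hx, fun h => absurd h hi, h, h⟩
  choose y z hy hz hne hyz hzy using hsol
  have hT := regularTree_adj_exists hd0
  exact ⟨_, _, homMeasure_levelOdds_ne hd0 hr hy hz hz hy (hne i₀ rfl),
    RootedForest.isGibbs_homMeasure _ hT (levelOdds_pos d hr hy hz) hlam
      (levelOdds_boundaryLaw d hy hyz hzy),
    RootedForest.isGibbs_homMeasure _ hT (levelOdds_pos d hr hz hy) hlam
      (levelOdds_boundaryLaw d hz hzy hyz)⟩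

end RelStr

theorem mainTheorem7 :
    (∃ (H : Type) (_ : Fintype H) (_ : RelStr.threeBinary.Structure H),
      RelStr.DismantlesTo RelStr.threeBinary (H × H) (Set.diagonal H) ∧
      ∀ Δ : ℕ, 6 ≤ Δ →
        ∃ (V : Type) (_ : Countable V) (T : SimpleGraph V) (_ : T.LocallyFinite),
          T.IsTree ∧ T.IsRegularOfDegree Δ ∧
          RelStr.BoundedDegree RelStr.threeBinary (RelStr.ThreeCopies T) ∧
          ∀ lam : H → ℝ, (∀ a, 0 < lam a) →
            ∃ μ ν : Measure (RelStr.ThreeCopies T →[RelStr.threeBinary] H),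
              μ ≠ ν ∧ RelStr.IsGibbs lam μ ∧ RelStr.IsGibbs lam ν) ∧
    ¬ (∀ (L : FirstOrder.Language.{0, 0}) (_ : L.IsRelational)
        (H : Type) (_ : Fintype H) (_ : L.Structure H),
        (∃ K : Set (H × H), K ⊆ Set.diagonal H ∧ RelStr.DismantlesTo L (H × H) K) →
        ∀ (G : Type) (_ : Countable G) (_ : L.Structure G),
          RelStr.BoundedDegree L G → Nonempty (G →[L] H) →
          ∃ lam : H → ℝ, (∀ a, 0 < lam a) ∧
            ∃! μ : Measure (G →[L] H), RelStr.IsGibbs lam μ) := by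
  have hfin : ∀ d, (RelStr.regularTree d).graph.LocallyFinite := fun d v =>
    (((RelStr.regularTree d).children v).finite_toSet.union
      ((RelStr.regularTree d).par v).toFinset.finite_toSet).subset (by
        rintro u (h | h)
        · exact Or.inr (by simpa using h)
        · exact Or.inl ((RelStr.regularTree d).mem_children.2 h)) |>.fintype
  refine ⟨⟨Fin 3, inferInstance, inferInstance, RelStr.dismantlesTo_diagonal, fun Δ hΔ => ?_⟩, ?_⟩
  · obtain ⟨d, rfl⟩ : ∃ d, Δ = d + 1 := ⟨Δ - 1, by omega⟩
    have hreg := RelStr.isRegularOfDegree_regularTree d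
    exact ⟨RelStr.TreeVertex d, inferInstance, (RelStr.regularTree d).graph, hfin d,
      RelStr.isTree_regularTree d, hreg, RelStr.boundedDegree_threeCopies _ hreg,
      fun lam hlam => RelStr.exists_isGibbs_ne (by omega) hlam⟩
  · intro hall
    have hreg := RelStr.isRegularOfDegree_regularTree 5
    obtain ⟨lam, hlam, _, -, huniq⟩ := hall RelStr.threeBinary inferInstance (Fin 3) inferInstance
      inferInstance ⟨_, subset_rfl, RelStr.dismantlesTo_diagonal⟩
      (RelStr.ThreeCopies (RelStr.regularTree 5).graph)
      (inferInstanceAs (Countable (Fin 3 × RelStr.TreeVertex 5))) inferInstance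
      (RelStr.boundedDegree_threeCopies _ hreg)
      ⟨(RelStr.regularTree 5).toHom (fun _ => false) (fun _ _ _ _ => rfl)⟩
    obtain ⟨μ, ν, hne, hμ, hν⟩ := RelStr.exists_isGibbs_ne le_rfl hlam
    exact hne ((huniq μ hμ).trans (huniq ν hν).symm)
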